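/- Let $A$ be a real $d_1\times d_2$ matrix, let $D$, $d$ be a real matrix and a real vector such that $\mathcal D=\{x\in\mathbb R^{d_1} : Dx\le d\}$ is a non-empty polytope (a polytope is the convex hull of finitely many points), and let $\mathcal F\subset\mathbb R^{d_3}$ be a polytope. For every $f\in\mathcal F$ let $E_f$, $e_f$ be a real matrix with $d_2$ columns and a real vector with as many entries as $E_f$ has rows (the number of rows may depend on $f$), and put $S_f=\{y\in\mathbb R^{d_2} : E_f y\le e_f\}$. Let \[B(f)=\Big\{x\in\mathcal D : \min_{y\in S_f} xAy\ \ge\ \min_{y\in S_f} x'Ay\ \text{ for all } x'\in\mathcal D\Big\}\] be the solution set of the program $\max_{x\in\mathcal D}\min_{y\in S_f}xAy$, where a minimum over the empty set is $+\infty$. Assume that the graph $\{(f,y) : f\in\mathcal F,\ y\in S_f\}$ of the correspondence $f\mapsto S_f$ is a polytope. Then $B$ is polytopial constant on $\mathcal F$, that is: there are a finite family $\{K(l) : l\in\mathcal L\}$ of polytopes and points $\{x(l) : l\in\mathcal L\}$ of $\mathbb R^{d_1}$ such that $\bigcup_{l}K(l)=\mathcal F$, every $K(l)$ has non-empty interior,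 $K(l)\cap K(l')$ has empty interior whenever $l\ne l'$ (interiors being taken in the affine subspace generated by $\mathcal F$), and $x(l)\in B(f)$ for every $l\in\mathcal L$ and every $f\in K(l)$. -/

import Mathlib

open scoped Matrix

namespace PPMP

/-- A polytope: the convex hull of a finite set of points. -/
def IsPolytope {V : Type*} [AddCommGroup V] [Module ℝ V] (P : Set V) : Prop :=
  ∃ s : Set V, s.Finite ∧ P = convexHull ℝ s

/-- `P` has non-empty interior inside the affine subspace generated by `K`. -/
def HasRelInterior {n : ℕ} (K P : Set (Fin n → ℝ)) : Prop :=
  (interior {z : affineSpan ℝ K | (z : Fin n → ℝ) ∈ P}).Nonempty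

/-- `{K l ; l ∈ L}` is a finite polytopial complex of `K`: a finite covering of `K` by polytopes
with non-empty interior such that any two of distinct indices intersect in a set with empty
interior, where interiors are taken in the affine subspace generated by `K`. -/
structure IsPolytopialComplex {n : ℕ} {L : Type*} (K : Set (Fin n → ℝ))
    (Kc : L → Set (Fin n → ℝ)) : Prop where
  finite : Finite L
  cover : ⋃ l, Kc l = K
  polytope : ∀ l, IsPolytope (Kc l)
  interior_nonempty : ∀ l, HasRelInterior K (Kc l)
  interior_inter : ∀ l l', l ≠ l' → ¬ HasRelInterior K (Kc l ∩ Kc l')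

/-- The correspondence `B` is polytopial constant on `K`: on each cell `Kc l` of some finite
polytopial complex of `K`, a fixed point `x l` belongs to all the values of `B`. -/
def PolytopialConstant {n m : ℕ} (K : Set (Fin n → ℝ))
    (B : (Fin n → ℝ) → Set (Fin m → ℝ)) : Prop :=
  ∃ (N : ℕ) (Kc : Fin N → Set (Fin n → ℝ)) (x : Fin N → (Fin m → ℝ)),
    IsPolytopialComplex K Kc ∧ ∀ l, ∀ f ∈ Kc l, x l ∈ B f

/-- The feasible set `{z ; M z ≤ b}` of a finite system of linear inequalities. -/
def feasible {k n : ℕ} (M : Matrix (Fin k) (Fin n) ℝ) (b : Fin k → ℝ) : Set (Fin n → ℝ) :=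
  {z | M *ᵥ z ≤ b}

/-- The graph over `F` of a correspondence `S`. -/
def graphOn {n m : ℕ} (F : Set (Fin n → ℝ)) (S : (Fin n → ℝ) → Set (Fin m → ℝ)) :
    Set ((Fin n → ℝ) × (Fin m → ℝ)) :=
  {p | p.1 ∈ F ∧ p.2 ∈ S p.1}

/-- The inner value `min_{y ∈ T} x A y`, as an extended real number. It is an ordinary minimum when
`T` is a non-empty polytope, and `+∞` when `T` is empty. -/
noncomputable def innerValue {m n : ℕ} (A : Matrix (Fin m) (Fin n) ℝ)
    (T : Set (Fin n → ℝ)) (x : Fin m → ℝ) : EReal :=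
  ⨅ y ∈ T, ((x ⬝ᵥ A *ᵥ y : ℝ) : EReal)

/-- The solution set of `max_{x ∈ C} min_{y ∈ T} x A y`: the `x ∈ C` at which the maximum of the
inner value over `C` is attained. -/
def solutionSet {m n : ℕ} (A : Matrix (Fin m) (Fin n) ℝ)
    (C : Set (Fin m → ℝ)) (T : Set (Fin n → ℝ)) : Set (Fin m → ℝ) :=
  {x | x ∈ C ∧ ∀ x' ∈ C, innerValue A T x' ≤ innerValue A T x}

end PPMP

/-!
Write `C = {x ; D x ≤ d}`, `G` for the graph of `f ↦ S_f` and `P` for its projection, the set of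
parameters with `S_f` non-empty. Three ingredients give the result.

*The value is a maximum of finitely many affine functions.* By weak duality the value of the program
at `f ∈ P` is at most `v f = min_{y ∈ S_f} max_{x ∈ C} x A y`. The epigraph of `v` is a projection
of a polyhedron, since the inner maximum may be taken over the finitely many generators of `C`. By
Fourier–Motzkin elimination (`IsHPolyhedron.exists_real`) it is itself cut out by finitely many
inequalities, so that `v = max_{ℓ ∈ Λ} ℓ` on `P` for a finite set `Λ` of affine functions
(`IsHPolyhedron.exists_affine_minorants`).

*Each of these functions is guaranteed by one point of `C`.* For `ℓ ∈ Λ`, every `(f, y) ∈ G` admits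
an `x ∈ C` with `x A y ≥ ℓ f`. The minimax theorem on `G × C`, with the parameter `f` on the side of
the minimizer, exchanges the quantifiers (`exists_uniform_bound`): there is one `x ℓ ∈ C` with
`x ℓ A y ≥ ℓ f` on all of `G`. At every `f ∈ P` where `ℓ` is the largest element of `Λ` one has
`ℓ f = v f`, so `x ℓ` is a solution there.

*An arrangement separates the regions.* The hyperplanes `ℓ = ℓ'` cut `F` into closed cells, and the
full-dimensional ones form a polytopial complex (`exists_polytopialComplex_sign`). On a cell `K` each
`ℓ - ℓ'` has constant weak sign, so an `ℓ` that is maximal at a suitable point of the convex set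
`K ∩ P` is maximal on all of it (`exists_forall_le_zero`). On `K \ P` every point of `C` is a
solution, so `x ℓ` is one on all of `K`. Working with `K ∩ P` rather than with a subdivision of `P`
covers the case where `P` is lower-dimensional than `F`.
-/

namespace PPMP

/-! ### Polyhedra and projections -/

/-- A polyhedron in half-space form: the common solution set of finitely many affine
inequalities `g x ≤ 0`. -/
def IsHPolyhedron {E : Type*} [AddCommGroup E] [Module ℝ E] (s : Set E) : Prop :=
  ∃ T : Finset (E →ᵃ[ℝ] ℝ), s = {x | ∀ g ∈ T, g x ≤ 0}

namespace IsHPolyhedron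

variable {E E' : Type*} [AddCommGroup E] [Module ℝ E] [AddCommGroup E'] [Module ℝ E']

lemma univ : IsHPolyhedron (Set.univ : Set E) := ⟨∅, by simp⟩

lemma halfSpace (g : E →ᵃ[ℝ] ℝ) : IsHPolyhedron {x | g x ≤ 0} := ⟨{g}, by simp⟩

lemma inter {s t : Set E} (hs : IsHPolyhedron s) (ht : IsHPolyhedron t) :
    IsHPolyhedron (s ∩ t) := by
  classical
  obtain ⟨S, rfl⟩ := hs
  obtain ⟨T, rfl⟩ := ht
  refine ⟨S ∪ T, ?_⟩
  ext x
  simp only [Set.mem_inter_iff, Set.mem_ofPred_eq, Finset.mem_union, or_imp, forall_and]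

lemma biInter {ι : Type*} (I : Finset ι) {s : ι → Set E} (h : ∀ i ∈ I, IsHPolyhedron (s i)) :
    IsHPolyhedron (⋂ i ∈ I, s i) := by
  classical
  induction I using Finset.induction_on with
  | empty => simpa using univ
  | insert a I ha ih =>
    rw [Finset.set_biInter_insert]
    exact (h a (by simp)).inter (ih fun i hi => h i (by simp [hi]))

lemma preimage {s : Set E'} (hs : IsHPolyhedron s) (φ : E →ᵃ[ℝ] E') :
    IsHPolyhedron (φ ⁻¹' s) := by
  classical
  obtain ⟨T, rfl⟩ := hs
  refine ⟨T.image fun g => g.comp φ, ?_⟩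
  ext x
  simp

lemma zero [FiniteDimensional ℝ E] : IsHPolyhedron ({0} : Set E) := by
  have key : ({0} : Set E) = (⋂ i ∈ (Finset.univ : Finset (Fin (Module.finrank ℝ E))),
      ({x | ((Module.finBasis ℝ E).coord i).toAffineMap x ≤ 0} ∩
        {x | (-(Module.finBasis ℝ E).coord i).toAffineMap x ≤ 0})) := by
    ext x
    simp only [Set.mem_singleton_iff, Set.mem_iInter, Set.mem_inter_iff, Set.mem_ofPred_eq,
      LinearMap.coe_toAffineMap, LinearMap.neg_apply, Finset.mem_univ, true_implies]
    constructor
    · rintro rfl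
      simp
    · intro h
      refine (Module.finBasis ℝ E).ext_elem fun i => ?_
      have := h i
      simp only [Module.Basis.coord_apply] at this
      simp only [map_zero, Finsupp.coe_zero, Pi.zero_apply]
      linarith
  rw [key]
  exact biInter _ fun i _ => (halfSpace _).inter (halfSpace _)

end IsHPolyhedron

lemma affineMap_prod_real_apply {E : Type*} [AddCommGroup E] [Module ℝ E] (g : E × ℝ →ᵃ[ℝ] ℝ)
    (x : E) (t : ℝ) : g (x, t) = g (x, 0) + t * g.linear (0, 1) := by
  have h := g.map_vadd (x, 0) ((0, t) : E × ℝ)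
  have h2 : ((0, t) : E × ℝ) = t • (0, 1) := by simp
  simp only [vadd_eq_add, Prod.mk_add_mk, zero_add, add_zero] at h
  rw [h, h2, map_smul, smul_eq_mul, add_comm]

/-- The affine map `x ↦ (x, 0)`. -/
def inlAffine (E : Type*) [AddCommGroup E] [Module ℝ E] : E →ᵃ[ℝ] E × ℝ :=
  (LinearMap.inl ℝ E ℝ).toAffineMap

@[simp] lemma inlAffine_apply {E : Type*} [AddCommGroup E] [Module ℝ E] (x : E) :
    inlAffine E x = (x, 0) := rfl

namespace IsHPolyhedron

variable {E : Type*} [AddCommGroup E] [Module ℝ E]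

/-- Fourier–Motzkin elimination of one real variable: every lower bound on the eliminated variable
is compared with every upper bound. -/
lemma exists_real {s : Set (E × ℝ)} (hs : IsHPolyhedron s) :
    IsHPolyhedron {x | ∃ t : ℝ, (x, t) ∈ s} := by
  classical
  obtain ⟨T, rfl⟩ := hs
  let b : (E × ℝ →ᵃ[ℝ] ℝ) → ℝ := fun g => g.linear (0, 1)
  have hb : ∀ g : E × ℝ →ᵃ[ℝ] ℝ, ∀ x t, g (x, t) = g (x, 0) + t * b g :=
    affineMap_prod_real_apply
  let T₀ := T.filter fun g => b g = 0
  let Tn := T.filter fun g => b g < 0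
  let Tp := T.filter fun g => 0 < b g
  have key : {x : E | ∃ t : ℝ, (x, t) ∈ {p : E × ℝ | ∀ g ∈ T, g p ≤ 0}} =
      (⋂ g ∈ T₀, {x | (g.comp (inlAffine E)) x ≤ 0}) ∩
      (⋂ p ∈ Tn ×ˢ Tp,
        {x | (b p.2 • p.1.comp (inlAffine E) - b p.1 • p.2.comp (inlAffine E)) x ≤ 0}) := by
    ext x
    simp only [Set.mem_ofPred_eq, Set.mem_inter_iff, Set.mem_iInter, AffineMap.comp_apply,
      inlAffine_apply, Finset.mem_product, AffineMap.coe_sub, AffineMap.coe_smul, Pi.sub_apply,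
      Pi.smul_apply, smul_eq_mul, T₀, Tn, Tp, Finset.mem_filter, Prod.forall]
    constructor
    · rintro ⟨t, ht⟩
      refine ⟨fun g hg => ?_, fun g g' hg => ?_⟩
      · have := ht g hg.1
        rw [hb, hg.2] at this
        simpa using this
      · have h1 := ht g hg.1.1
        have h2 := ht g' hg.2.1
        rw [hb] at h1 h2
        nlinarith [mul_le_mul_of_nonneg_left h1 hg.2.2.le,
          mul_le_mul_of_nonneg_left h2 (neg_nonneg.2 hg.1.2.le)]
    · rintro ⟨h0, hnp⟩
      -- every lower bound `-g (x, 0) / b g` is below every upper bound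
      obtain ⟨t, htn, htp⟩ : ∃ t : ℝ, (∀ g ∈ Tn, -g (x, 0) / b g ≤ t) ∧
          ∀ g ∈ Tp, t ≤ -g (x, 0) / b g := by
        have hle : ∀ g ∈ Tn, ∀ g' ∈ Tp, -g (x, 0) / b g ≤ -g' (x, 0) / b g' := by
          intro g hg g' hg'
          have hg := Finset.mem_filter.1 hg
          have hg' := Finset.mem_filter.1 hg'
          have := hnp g g' ⟨hg, hg'⟩
          rw [← neg_div_neg_eq, neg_neg, div_le_div_iff₀ (neg_pos.2 hg.2) hg'.2]
          linarith
        rcases Tn.eq_empty_or_nonempty with hn | hn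
        · rcases Tp.eq_empty_or_nonempty with hp | hp
          · exact ⟨0, by simp [hn], by simp [hp]⟩
          · exact ⟨Tp.inf' hp fun g => -g (x, 0) / b g, by simp [hn],
              fun g hg => Finset.inf'_le _ hg⟩
        · exact ⟨Tn.sup' hn fun g => -g (x, 0) / b g,
            fun g hg => Finset.le_sup' (fun g => -g (x, 0) / b g) hg,
            fun g' hg' => Finset.sup'_le _ _ fun g hg => hle g hg g' hg'⟩
      refine ⟨t, fun g hg => ?_⟩
      rw [hb]
      rcases lt_trichotomy (b g) 0 with h | h | h
      · have := htn g (Finset.mem_filter.2 ⟨hg, h⟩)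
        rw [div_le_iff_of_neg h] at this
        linarith
      · have := h0 g ⟨hg, h⟩
        rw [h]
        linarith
      · have := htp g (Finset.mem_filter.2 ⟨hg, h⟩)
        rw [le_div_iff₀ h] at this
        linarith
  rw [key]
  exact (biInter _ fun g _ => halfSpace _).inter (biInter _ fun p _ => halfSpace _)

lemma exists_fin {n : ℕ} {s : Set (E × (Fin n → ℝ))} (hs : IsHPolyhedron s) :
    IsHPolyhedron {x | ∃ v : Fin n → ℝ, (x, v) ∈ s} := by
  induction n generalizing E with
  | zero =>
    have h := hs.preimage (LinearMap.inl ℝ E (Fin 0 → ℝ)).toAffineMap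
    convert h using 1
    ext x
    simp only [Set.mem_ofPred_eq, Set.mem_preimage, LinearMap.coe_toAffineMap,
      LinearMap.inl_apply]
    exact ⟨fun ⟨v, hv⟩ => Subsingleton.elim v 0 ▸ hv, fun h => ⟨0, h⟩⟩
  | succ n ih =>
    let φ : (E × ℝ) × (Fin n → ℝ) →ₗ[ℝ] E × (Fin (n + 1) → ℝ) :=
      { toFun := fun p => (p.1.1, Fin.cons p.1.2 p.2)
        map_add' := fun p q => by
          refine Prod.ext rfl (funext fun i => ?_)
          refine Fin.cases ?_ (fun j => ?_) i <;> simp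
        map_smul' := fun c p => by
          refine Prod.ext rfl (funext fun i => ?_)
          refine Fin.cases ?_ (fun j => ?_) i <;> simp }
    have h := (ih (hs.preimage φ.toAffineMap)).exists_real
    convert h using 1
    ext x
    simp only [Set.mem_ofPred_eq, Set.mem_preimage, LinearMap.coe_toAffineMap]
    constructor
    · rintro ⟨v, hv⟩
      exact ⟨v 0, Fin.tail v, by simpa [φ, Fin.cons_self_tail] using hv⟩
    · rintro ⟨t, v, hv⟩
      exact ⟨Fin.cons t v, hv⟩

end IsHPolyhedron

/-- The convex hull of finitely many points is the projection of the polyhedron of pairs formed by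
a point and its vector of convex weights. -/
lemma IsPolytope.isHPolyhedron {E : Type*} [AddCommGroup E] [Module ℝ E] [FiniteDimensional ℝ E]
    {s : Set E} (hs : IsPolytope s) : IsHPolyhedron s := by
  obtain ⟨V, hV, rfl⟩ := hs
  obtain ⟨n, g, hg, rfl⟩ := hV.fin_param
  have key : convexHull ℝ (Set.range g) = {x | ∃ w : Fin n → ℝ,
      (∀ i, 0 ≤ w i) ∧ ∑ i, w i = 1 ∧ ∑ i, w i • g i = x} := by
    classical
    ext x
    constructor
    · intro hx
      have hr : Set.range g = (Finset.univ.image g : Finset E) := by simp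
      rw [hr, Finset.mem_convexHull'] at hx
      obtain ⟨w, h0, h1, hx⟩ := hx
      rw [Finset.sum_image hg.injOn] at h1 hx
      exact ⟨w ∘ g, fun i => h0 _ (by simp), h1, hx⟩
    · rintro ⟨w, h0, h1, hx⟩
      exact mem_convexHull_of_exists_fintype w g h0 h1 (fun i => ⟨i, rfl⟩) hx
  let coord : Fin n → E × (Fin n → ℝ) →ₗ[ℝ] ℝ := fun i =>
    LinearMap.proj i ∘ₗ LinearMap.snd ℝ E (Fin n → ℝ)
  let comb : E × (Fin n → ℝ) →ₗ[ℝ] E :=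
    (∑ i, (coord i).smulRight (g i)) - LinearMap.fst ℝ E (Fin n → ℝ)
  let excess : E × (Fin n → ℝ) →ᵃ[ℝ] ℝ :=
    (∑ i, coord i).toAffineMap - AffineMap.const ℝ (E × (Fin n → ℝ)) (1 : ℝ)
  have hpoly : IsHPolyhedron
      (((⋂ i ∈ (Finset.univ : Finset (Fin n)), {p | (-coord i).toAffineMap p ≤ 0}) ∩
        excess ⁻¹' {0}) ∩
        comb.toAffineMap ⁻¹' {0}) :=
    ((IsHPolyhedron.biInter _ fun i _ => .halfSpace _).inter
      (IsHPolyhedron.zero.preimage _)).inter (IsHPolyhedron.zero.preimage _)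
  rw [key]
  convert hpoly.exists_fin using 1
  ext x
  simp [coord, comb, excess, sub_eq_zero, and_assoc]

/-- A polyhedron in `E × ℝ` that is closed upwards and contains no vertical line is the epigraph,
over a subset of `E`, of the maximum of finitely many affine functions. -/
lemma IsHPolyhedron.exists_affine_minorants {E : Type*} [AddCommGroup E] [Module ℝ E]
    {s : Set (E × ℝ)} (hs : IsHPolyhedron s)
    (hup : ∀ x t t', (x, t) ∈ s → t ≤ t' → (x, t') ∈ s)
    (hline : ∀ x, ∃ t, (x, t) ∉ s) :
    ∃ Λ : Finset (E →ᵃ[ℝ] ℝ), (∀ x t, (x, t) ∈ s → ∀ ℓ ∈ Λ, ℓ x ≤ t) ∧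
      (s.Nonempty → Λ.Nonempty) ∧
      ∀ x t, (x, t) ∈ s → ∀ c, (∀ ℓ ∈ Λ, ℓ x ≤ c) → (x, c) ∈ s := by
  classical
  obtain ⟨T, rfl⟩ := hs
  let b : (E × ℝ →ᵃ[ℝ] ℝ) → ℝ := fun g => g.linear (0, 1)
  have hb : ∀ g : E × ℝ →ᵃ[ℝ] ℝ, ∀ x t, g (x, t) = g (x, 0) + t * b g :=
    affineMap_prod_real_apply
  have hbneg : ∀ x t, (x, t) ∈ {p : E × ℝ | ∀ g ∈ T, g p ≤ 0} → ∀ g ∈ T, b g ≤ 0 := by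
    intro x t hxt g hg
    by_contra! hpos
    have h := hup x t (max t ((1 - g (x, 0)) / b g)) hxt (le_max_left _ _) g hg
    have h2 : (1 - g (x, 0)) / b g ≤ max t ((1 - g (x, 0)) / b g) := le_max_right _ _
    rw [div_le_iff₀ hpos] at h2
    rw [hb] at h
    linarith
  let Tn := T.filter fun g => b g < 0
  let Λ := Tn.image fun g => (-(b g)⁻¹) • g.comp (inlAffine E)
  have hΛ : ∀ x c, (∀ ℓ ∈ Λ, ℓ x ≤ c) ↔ ∀ g ∈ T, b g < 0 → g (x, c) ≤ 0 := by
    intro x c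
    simp only [Λ, Tn, Finset.forall_mem_image, Finset.mem_filter, and_imp]
    refine forall₃_congr fun g _ hg => ?_
    rw [hb g x c]
    simp only [AffineMap.coe_smul, Pi.smul_apply, AffineMap.comp_apply, inlAffine_apply,
      smul_eq_mul]
    rw [neg_mul, ← mul_neg, mul_comm, ← div_eq_mul_inv, div_le_iff_of_neg hg]
    constructor <;> intro h <;> linarith
  have hfill : ∀ x t, (x, t) ∈ {p : E × ℝ | ∀ g ∈ T, g p ≤ 0} → ∀ c, (∀ ℓ ∈ Λ, ℓ x ≤ c) →
      (x, c) ∈ {p : E × ℝ | ∀ g ∈ T, g p ≤ 0} := by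
    intro x t hxt c hc g hg
    rcases (hbneg x t hxt g hg).lt_or_eq with h | h
    · exact (hΛ x c).1 hc g hg h
    · have h1 := hxt g hg
      rw [hb, h] at h1 ⊢
      simpa using h1
  refine ⟨Λ, fun x t hxt => (hΛ x t).2 fun g hg _ => hxt g hg, ?_, hfill⟩
  rintro ⟨⟨x, t⟩, hxt⟩
  by_contra hne
  rw [Finset.not_nonempty_iff_eq_empty] at hne
  obtain ⟨c, hc⟩ := hline x
  exact hc (hfill x t hxt c (by simp [hne]))

/-- A point of a polyhedron that is extreme is determined by the inequalities active at it, so there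
are finitely many of them, and the Krein–Milman theorem applies. -/
lemma IsHPolyhedron.isPolytope {E : Type*} [NormedAddCommGroup E] [NormedSpace ℝ E]
    [FiniteDimensional ℝ E] {s : Set E} (hs : IsHPolyhedron s) (hc : IsCompact s)
    (hconv : Convex ℝ s) : IsPolytope s := by
  classical
  obtain ⟨T, rfl⟩ := hs
  set s := {x : E | ∀ g ∈ T, g x ≤ 0} with hsdef
  have hfin : (s.extremePoints ℝ).Finite := by
    refine Set.Finite.of_finite_image (f := fun x => T.filter fun g => g x = 0)
      ((T.powerset.finite_toSet).subset ?_) ?_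
    · rintro _ ⟨x, -, rfl⟩
      exact Finset.mem_coe.2 (Finset.mem_powerset.2 (Finset.filter_subset _ _))
    · intro x hx y hy hxy
      have hxy : T.filter (fun g => g x = 0) = T.filter (fun g => g y = 0) := hxy
      have hact : ∀ g ∈ T, g x = 0 → g y = 0 := by
        intro g hg h0
        have : g ∈ T.filter (fun g => g x = 0) := Finset.mem_filter.2 ⟨hg, h0⟩
        rw [hxy] at this
        exact (Finset.mem_filter.1 this).2
      -- a small extension of the segment from `y` to `x` beyond `x` stays in the polyhedron
      obtain ⟨ε, hε, hext⟩ : ∃ ε : ℝ, 0 < ε ∧ ∀ g ∈ T, g x + ε * (g x - g y) ≤ 0 := by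
        have hev : ∀ᶠ ε : ℝ in nhdsWithin 0 (Set.Ioi 0),
            ∀ g ∈ T, g x + ε * (g x - g y) ≤ 0 := by
          rw [Filter.eventually_all_finset]
          intro g hg
          rcases (hx.1 g hg).lt_or_eq with h | h
          · have hcont : Continuous fun ε : ℝ => g x + ε * (g x - g y) := by fun_prop
            have ht := hcont.tendsto 0
            simp only [zero_mul, add_zero] at ht
            exact ((ht.eventually (gt_mem_nhds h)).mono fun _ h => h.le).filter_mono
              nhdsWithin_le_nhds
          · simp [h, hact g hg h]
        obtain ⟨ε, h1, h2⟩ := (hev.and self_mem_nhdsWithin).exists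
        exact ⟨ε, h2, h1⟩
      have hz : AffineMap.lineMap x y (-ε) ∈ s := by
        intro g hg
        rw [AffineMap.apply_lineMap, AffineMap.lineMap_apply_ring']
        linarith [hext g hg]
      have hseg : x ∈ openSegment ℝ (AffineMap.lineMap x y (-ε)) y := by
        refine ⟨1 / (1 + ε), ε / (1 + ε), by positivity, by positivity, by field_simp, ?_⟩
        rw [AffineMap.lineMap_apply_module]
        match_scalars <;> field_simp <;> ring
      exact (hx.2 hy.1 hz (openSegment_symm ℝ _ y ▸ hseg)).symm
  refine ⟨_, hfin, ?_⟩
  have h := closure_convexHull_extremePoints hc hconv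
  rw [(Set.Finite.isClosed_convexHull ℝ hfin).closure_eq] at h
  exact h.symm

/-! ### The cells of a hyperplane arrangement -/

/-- The closed cell of the arrangement `{h = 0 ; h ∈ H}` inside `F` on which the functionals in `A`
are nonnegative and the other ones nonpositive. -/
def cell {n : ℕ} (F : Set (Fin n → ℝ)) (H A : Finset ((Fin n → ℝ) →ᵃ[ℝ] ℝ)) :
    Set (Fin n → ℝ) :=
  {f | f ∈ F ∧ (∀ h ∈ A, 0 ≤ h f) ∧ ∀ h ∈ H, h ∉ A → h f ≤ 0}

lemma IsPolytope.convex {E : Type*} [AddCommGroup E] [Module ℝ E] {s : Set E}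
    (hs : IsPolytope s) : Convex ℝ s := by
  obtain ⟨V, -, rfl⟩ := hs
  exact convex_convexHull ℝ V

lemma IsPolytope.isCompact {E : Type*} [NormedAddCommGroup E] [NormedSpace ℝ E] {s : Set E}
    (hs : IsPolytope s) : IsCompact s := by
  obtain ⟨V, hV, rfl⟩ := hs
  exact Set.Finite.isCompact_convexHull ℝ hV

lemma IsPolytope.inter_halfSpace {E : Type*} [NormedAddCommGroup E] [NormedSpace ℝ E]
    [FiniteDimensional ℝ E] {s : Set E} (hs : IsPolytope s) (h : E →ᵃ[ℝ] ℝ) :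
    IsPolytope (s ∩ {x | h x ≤ 0}) := by
  refine (hs.isHPolyhedron.inter (.halfSpace h)).isPolytope (hs.isCompact.inter_right ?_)
    (hs.convex.inter ?_)
  · exact isClosed_le h.continuous_of_finiteDimensional continuous_const
  · exact (convex_Iic (0 : ℝ)).affine_preimage h

lemma IsPolytope.inter_halfSpaces {E : Type*} [NormedAddCommGroup E] [NormedSpace ℝ E]
    [FiniteDimensional ℝ E] {s : Set E} (hs : IsPolytope s) (T : Finset (E →ᵃ[ℝ] ℝ)) :
    IsPolytope (s ∩ {x | ∀ h ∈ T, h x ≤ 0}) := by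
  classical
  induction T using Finset.induction_on with
  | empty => simpa using hs
  | insert h T _ ih =>
    convert ih.inter_halfSpace h using 1
    ext x
    simp only [Set.mem_inter_iff, Set.mem_ofPred_eq, Finset.forall_mem_insert]
    tauto

lemma isPolytope_cell {n : ℕ} {F : Set (Fin n → ℝ)} (hF : IsPolytope F)
    (H A : Finset ((Fin n → ℝ) →ᵃ[ℝ] ℝ)) : IsPolytope (cell F H A) := by
  classical
  have key : cell F H A = F ∩ {x | ∀ h ∈ A.image Neg.neg ∪ H \ A, h x ≤ 0} := by
    ext x
    simp only [cell, Set.mem_inter_iff, Set.mem_ofPred_eq, Finset.mem_union, or_imp, forall_and,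
      Finset.forall_mem_image, Finset.mem_sdiff, and_imp, AffineMap.coe_neg, Pi.neg_apply,
      neg_nonpos]
  rw [key]
  exact hF.inter_halfSpaces _

/-- The zero set of an affine functional that does not vanish identically on `F` has empty relative
interior: on a line through a point of the span where it is nonzero it has at most one zero. -/
lemma not_hasRelInterior_of_eq_zero {n : ℕ} {F P : Set (Fin n → ℝ)} {h : (Fin n → ℝ) →ᵃ[ℝ] ℝ}
    {w : Fin n → ℝ} (hw : w ∈ F) (hne : h w ≠ 0) (hP : ∀ z ∈ P, h z = 0) :
    ¬ HasRelInterior F P := by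
  rintro ⟨z, hz⟩
  let w' : affineSpan ℝ F := ⟨w, subset_affineSpan ℝ F hw⟩
  have : Nonempty (affineSpan ℝ F) := ⟨w'⟩
  have hsub : ∀ y ∈ interior {z : affineSpan ℝ F | (z : Fin n → ℝ) ∈ P}, h y = 0 := fun y hy =>
    hP y (interior_subset (s := {z : affineSpan ℝ F | (z : Fin n → ℝ) ∈ P}) hy)
  have hz0 : h z = 0 := hsub z hz
  have hcont : Continuous fun t : ℝ => AffineMap.lineMap z w' t := AffineMap.lineMap_continuous
  have hev : ∀ᶠ t : ℝ in nhds 0, AffineMap.lineMap z w' t ∈ interior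
      {z : affineSpan ℝ F | (z : Fin n → ℝ) ∈ P} :=
    (hcont.tendsto' 0 z (by simp)).eventually (isOpen_interior.mem_nhds hz)
  obtain ⟨t, ht, htpos⟩ :=
    ((hev.filter_mono nhdsWithin_le_nhds).and (self_mem_nhdsWithin (s := Set.Ioi 0))).exists
  have h0 := hsub _ ht
  have hcoe : ((AffineMap.lineMap z w' t : affineSpan ℝ F) : Fin n → ℝ) =
      AffineMap.lineMap (z : Fin n → ℝ) w t :=
    (affineSpan ℝ F).subtype.apply_lineMap z w' t
  rw [hcoe, AffineMap.apply_lineMap, hz0, AffineMap.lineMap_apply_ring'] at h0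
  rcases mul_eq_zero.1 (by linarith : t * h w = 0) with h1 | h1
  · exact (ne_of_gt htpos) h1
  · exact hne h1

/-- A convex set contains, in its relative interior, points off finitely many hyperplanes none of
which contains it. -/
lemma exists_mem_interior_forall_ne_zero {n : ℕ} {F : Set (Fin n → ℝ)} (hF : Convex ℝ F)
    (hne : F.Nonempty) (H : Finset ((Fin n → ℝ) →ᵃ[ℝ] ℝ)) (hH : ∀ h ∈ H, ∃ w ∈ F, h w ≠ 0) :
    ∃ c ∈ interior {z : affineSpan ℝ F | (z : Fin n → ℝ) ∈ F}, ∀ h ∈ H, h (c : Fin n → ℝ) ≠ 0 := by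
  classical
  induction H using Finset.induction_on with
  | empty =>
    obtain ⟨_, z, hz, -⟩ := hne.intrinsicInterior hF
    exact ⟨z, hz, by simp⟩
  | insert h H _ ih =>
    obtain ⟨c, hc, hcH⟩ := ih fun g hg => hH g (Finset.mem_insert_of_mem hg)
    obtain ⟨w, hw, hhw⟩ := hH h (Finset.mem_insert_self _ _)
    let U : Set (affineSpan ℝ F) := interior {z : affineSpan ℝ F | (z : Fin n → ℝ) ∈ F} ∩
      {z | ∀ g ∈ H, g (z : Fin n → ℝ) ≠ 0}
    have hU : IsOpen U := by
      refine isOpen_interior.inter ?_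
      have : {z : affineSpan ℝ F | ∀ g ∈ H, g (z : Fin n → ℝ) ≠ 0} =
          ⋂ g ∈ H, {z : affineSpan ℝ F | g (z : Fin n → ℝ) ≠ 0} := by
        ext z
        simp
      rw [this]
      exact isOpen_biInter_finset fun g _ => isOpen_ne_fun
        (g.continuous_of_finiteDimensional.comp continuous_subtype_val) continuous_const
    by_contra! hcon
    refine not_hasRelInterior_of_eq_zero (P := (↑) '' U) hw hhw ?_ ⟨c, ?_⟩
    · rintro _ ⟨z, hz, rfl⟩
      obtain ⟨g, hg, hgz⟩ := hcon z hz.1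
      rcases Finset.mem_insert.1 hg with rfl | hg
      · exact hgz
      · exact absurd hgz (hz.2 g hg)
    · exact interior_maximal (fun z hz => Set.mem_image_of_mem Subtype.val hz) hU ⟨hc, hcH⟩

/-- Walking from `f` a little towards a generic point of the relative interior leads into the
interior of a cell that contains `f`. -/
lemma exists_cell {n : ℕ} {F : Set (Fin n → ℝ)} (hF : Convex ℝ F)
    (H : Finset ((Fin n → ℝ) →ᵃ[ℝ] ℝ)) (hH : ∀ h ∈ H, ∃ w ∈ F, h w ≠ 0) {f : Fin n → ℝ}
    (hf : f ∈ F) : ∃ A ⊆ H, f ∈ cell F H A ∧ HasRelInterior F (cell F H A) := by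
  classical
  obtain ⟨c, hc, hcH⟩ := exists_mem_interior_forall_ne_zero hF ⟨f, hf⟩ H hH
  let f' : affineSpan ℝ F := ⟨f, subset_affineSpan ℝ F hf⟩
  have : Nonempty (affineSpan ℝ F) := ⟨f'⟩
  let A := H.filter fun h => 0 < h f ∨ (h f = 0 ∧ 0 < h (c : Fin n → ℝ))
  have hpos : ∀ a b : ℝ, (0 < a ∨ (a = 0 ∧ 0 < b)) →
      ∀ᶠ t : ℝ in nhdsWithin 0 (Set.Ioi 0), 0 < AffineMap.lineMap a b t := by
    intro a b hab
    rcases hab with ha | ⟨rfl, hb⟩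
    · have hcont : Continuous fun t : ℝ => AffineMap.lineMap a b t :=
        AffineMap.lineMap_continuous
      exact ((hcont.tendsto' 0 a (by simp)).eventually (lt_mem_nhds ha)).filter_mono
        nhdsWithin_le_nhds
    · filter_upwards [self_mem_nhdsWithin] with t ht
      rw [AffineMap.lineMap_apply_ring']
      have := mul_pos ht hb
      linarith
  have hA : ∀ h ∈ A, 0 < h f ∨ (h f = 0 ∧ 0 < h (c : Fin n → ℝ)) := fun h hh =>
    (Finset.mem_filter.1 hh).2
  have hnA : ∀ h ∈ H, h ∉ A → 0 < -h f ∨ (-h f = 0 ∧ 0 < -h (c : Fin n → ℝ)) := by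
    intro h hh hhA
    have h1 : ¬ (0 < h f ∨ (h f = 0 ∧ 0 < h (c : Fin n → ℝ))) := fun h2 =>
      hhA (Finset.mem_filter.2 ⟨hh, h2⟩)
    push Not at h1
    rcases h1.1.lt_or_eq with h2 | h2
    · exact Or.inl (by linarith)
    · exact Or.inr ⟨by linarith, by have := lt_of_le_of_ne (h1.2 h2) (hcH h hh); linarith⟩
  have hAH : A ⊆ H := Finset.filter_subset _ _
  have hev : ∀ᶠ t : ℝ in nhdsWithin 0 (Set.Ioi 0),
      (∀ h ∈ A, 0 < h (AffineMap.lineMap f (c : Fin n → ℝ) t)) ∧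
      ∀ h ∈ H \ A, h (AffineMap.lineMap f (c : Fin n → ℝ) t) < 0 := by
    rw [Filter.eventually_and, Filter.eventually_all_finset, Filter.eventually_all_finset]
    refine ⟨fun h hh => ?_, fun h hh => ?_⟩
    · simpa only [AffineMap.apply_lineMap] using hpos _ _ (hA h hh)
    · obtain ⟨hh, hhA⟩ := Finset.mem_sdiff.1 hh
      filter_upwards [hpos _ _ (hnA h hh hhA)] with t ht
      rw [AffineMap.apply_lineMap]
      rw [AffineMap.lineMap_apply_ring'] at ht ⊢
      linarith
  have hlt : ∀ᶠ t : ℝ in nhdsWithin 0 (Set.Ioi 0), t < 1 :=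
    (gt_mem_nhds one_pos).filter_mono nhdsWithin_le_nhds
  obtain ⟨t, ⟨⟨htA, htnA⟩, ht1⟩, ht0⟩ := ((hev.and hlt).and self_mem_nhdsWithin).exists
  have ht0 : 0 < t := ht0
  refine ⟨A, hAH, ⟨hf, fun h hh => ?_, fun h hh hhA => ?_⟩, AffineMap.homothety f' t c, ?_⟩
  · rcases hA h hh with h1 | h1
    · exact h1.le
    · exact h1.1.ge
  · rcases hnA h hh hhA with h1 | h1 <;> linarith [h1]
  -- the homothety with centre `f` and ratio `t` is open and maps `F` into itself
  have hcoe : ∀ z : affineSpan ℝ F, ((AffineMap.homothety f' t z : affineSpan ℝ F) : Fin n → ℝ) =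
      AffineMap.lineMap f (z : Fin n → ℝ) t := fun z =>
    (affineSpan ℝ F).subtype.apply_lineMap f' z t
  let V : Set (affineSpan ℝ F) :=
    AffineMap.homothety f' t '' interior {z : affineSpan ℝ F | (z : Fin n → ℝ) ∈ F} ∩
    ((⋂ h ∈ A, {z : affineSpan ℝ F | 0 < h (z : Fin n → ℝ)}) ∩
      ⋂ h ∈ H \ A, {z : affineSpan ℝ F | h (z : Fin n → ℝ) < 0})
  have hcts : ∀ h : (Fin n → ℝ) →ᵃ[ℝ] ℝ, Continuous fun z : affineSpan ℝ F => h (z : Fin n → ℝ) :=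
    fun h => h.continuous_of_finiteDimensional.comp continuous_subtype_val
  have hV : IsOpen V :=
    (AffineMap.homothety_isOpenMap f' t ht0.ne' _ isOpen_interior).inter
      ((isOpen_biInter_finset fun h _ => isOpen_lt continuous_const (hcts h)).inter
        (isOpen_biInter_finset fun h _ => isOpen_lt (hcts h) continuous_const))
  refine interior_maximal ?_ hV ⟨⟨c, hc, rfl⟩, ?_, ?_⟩
  · rintro _ ⟨⟨z, hz, rfl⟩, h1, h2⟩
    simp only [Set.mem_iInter, Set.mem_ofPred_eq] at h1 h2
    refine ⟨?_, fun h hh => (h1 h hh).le, fun h hh hhA =>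
      (h2 h (Finset.mem_sdiff.2 ⟨hh, hhA⟩)).le⟩
    rw [hcoe]
    exact hF.lineMap_mem hf
      (interior_subset (s := {z : affineSpan ℝ F | (z : Fin n → ℝ) ∈ F}) hz) ⟨ht0.le, ht1.le⟩
  · simp only [Set.mem_iInter, Set.mem_ofPred_eq, hcoe]
    exact htA
  · simp only [Set.mem_iInter, Set.mem_ofPred_eq, hcoe]
    exact htnA

/-- The full-dimensional closed cells of an arrangement of finitely many hyperplanes form a
polytopial complex of `F`. Functionals vanishing identically on `F` are left out of the arrangement,
as they would not separate cells. -/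
lemma exists_polytopialComplex_sign {n : ℕ} {F : Set (Fin n → ℝ)} (hF : IsPolytope F)
    (H : Finset ((Fin n → ℝ) →ᵃ[ℝ] ℝ)) :
    ∃ (N : ℕ) (Kc : Fin N → Set (Fin n → ℝ)), IsPolytopialComplex F Kc ∧
      ∀ l, ∀ h ∈ H, (∀ f ∈ Kc l, 0 ≤ h f) ∨ ∀ f ∈ Kc l, h f ≤ 0 := by
  classical
  let H' := H.filter fun h => ∃ w ∈ F, h w ≠ 0
  let I := H'.powerset.filter fun A => HasRelInterior F (cell F H' A)
  let e := I.equivFin.symm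
  have hI : ∀ l, (e l).1 ⊆ H' ∧ HasRelInterior F (cell F H' (e l).1) := fun l => by
    have := Finset.mem_filter.1 (e l).2
    exact ⟨Finset.mem_powerset.1 this.1, this.2⟩
  refine ⟨I.card, fun l => cell F H' (e l).1, ⟨inferInstance, ?_, fun l => isPolytope_cell hF _ _,
    fun l => (hI l).2, ?_⟩, ?_⟩
  · refine Set.Subset.antisymm (Set.iUnion_subset fun l f hf => hf.1) fun f hf => ?_
    obtain ⟨A, hA, hfA, hint⟩ := exists_cell hF.convex H'
      (fun h hh => (Finset.mem_filter.1 hh).2) hf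
    refine Set.mem_iUnion.2 ⟨e.symm ⟨A, Finset.mem_filter.2 ⟨Finset.mem_powerset.2 hA, hint⟩⟩, ?_⟩
    simpa using hfA
  · intro l l' hll
    have hne : (e l).1 ≠ (e l').1 := fun h => hll (e.injective (Subtype.ext h))
    obtain ⟨h, hh⟩ : ∃ h, ¬ (h ∈ (e l).1 ↔ h ∈ (e l').1) := by
      by_contra! hcon
      exact hne (Finset.ext hcon)
    have hhH : h ∈ H' := by
      by_contra hcon
      exact hh ⟨fun h1 => absurd ((hI l).1 h1) hcon, fun h1 => absurd ((hI l').1 h1) hcon⟩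
    obtain ⟨w, hw, hhw⟩ := (Finset.mem_filter.1 hhH).2
    refine not_hasRelInterior_of_eq_zero hw hhw ?_
    rintro z ⟨hz, hz'⟩
    by_cases h1 : h ∈ (e l).1
    · have h2 : h ∉ (e l').1 := fun h2 => hh (by simp [h1, h2])
      exact le_antisymm (hz'.2.2 h hhH h2) (hz.2.1 h h1)
    · have h2 : h ∈ (e l').1 := by
        by_contra h2
        exact hh (by simp [h1, h2])
      exact le_antisymm (hz.2.2 h hhH h1) (hz'.2.1 h h2)
  · intro l h hh
    by_cases hhH : h ∈ H'
    · by_cases h1 : h ∈ (e l).1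
      · exact Or.inl fun f hf => hf.2.1 h h1
      · exact Or.inr fun f hf => hf.2.2 h hhH h1
    · refine Or.inl fun f hf => ?_
      by_contra hlt
      exact hhH (Finset.mem_filter.2 ⟨hh, f, hf.1, fun h0 => hlt h0.ge⟩)

/-- On a convex set where finitely many affine functionals have constant sign, some point satisfies
as few as possible of the inequalities `h ≤ 0`; it is obtained by averaging, and plays the role of a
relative interior point. -/
lemma exists_forall_le_zero {E : Type*} [AddCommGroup E] [Module ℝ E] {S : Set E}
    (hS : Convex ℝ S) (hne : S.Nonempty) (H : Finset (E →ᵃ[ℝ] ℝ))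
    (hsign : ∀ h ∈ H, (∀ x ∈ S, 0 ≤ h x) ∨ ∀ x ∈ S, h x ≤ 0) :
    ∃ c ∈ S, ∀ h ∈ H, h c ≤ 0 → ∀ x ∈ S, h x ≤ 0 := by
  classical
  induction H using Finset.induction_on with
  | empty => exact ⟨hne.choose, hne.choose_spec, by simp⟩
  | insert g H _ ih =>
    obtain ⟨c, hc, hcH⟩ := ih fun h hh => hsign h (Finset.mem_insert_of_mem hh)
    by_cases hg : ∀ x ∈ S, g x ≤ 0
    · refine ⟨c, hc, Finset.forall_mem_insert _ _ _ |>.2 ⟨fun _ => hg, hcH⟩⟩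
    have hg0 := (hsign g (Finset.mem_insert_self _ _)).resolve_right hg
    push Not at hg
    obtain ⟨x, hx, hgx⟩ := hg
    have hmid : ∀ h : E →ᵃ[ℝ] ℝ, h (AffineMap.lineMap c x (1 / 2 : ℝ)) = (h c + h x) / 2 := by
      intro h
      rw [AffineMap.apply_lineMap, AffineMap.lineMap_apply_ring']
      ring
    refine ⟨AffineMap.lineMap c x (1 / 2 : ℝ), hS.lineMap_mem hc hx (by norm_num),
      Finset.forall_mem_insert _ _ _ |>.2 ⟨fun h => ?_, fun h hh hle => ?_⟩⟩
    · rw [hmid] at h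
      linarith [hg0 c hc]
    · rcases hsign h (Finset.mem_insert_of_mem hh) with h0 | h0
      · rw [hmid] at hle
        exact hcH h hh (by linarith [h0 x hx])
      · exact h0

/-! ### Parametric minimax -/

/-- If every point of `G` admits some `x ∈ C` with `ℓ f ≤ x A y`, then by the minimax theorem a
single `x ∈ C` serves all points of `G`. -/
lemma exists_uniform_bound {d₁ d₂ d₃ : ℕ} (A : Matrix (Fin d₁) (Fin d₂) ℝ)
    {C : Set (Fin d₁ → ℝ)} (hC : IsPolytope C) (hCne : C.Nonempty)
    {G : Set ((Fin d₃ → ℝ) × (Fin d₂ → ℝ))} (hG : IsPolytope G)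
    (ℓ : (Fin d₃ → ℝ) →ᵃ[ℝ] ℝ) (h : ∀ p ∈ G, ∃ x ∈ C, ℓ p.1 ≤ x ⬝ᵥ A *ᵥ p.2) :
    ∃ x ∈ C, ∀ p ∈ G, ℓ p.1 ≤ x ⬝ᵥ A *ᵥ p.2 := by
  rcases G.eq_empty_or_nonempty with rfl | hGne
  · exact ⟨hCne.choose, hCne.choose_spec, by simp⟩
  let φ : (Fin d₃ → ℝ) × (Fin d₂ → ℝ) → (Fin d₁ → ℝ) → ℝ := fun p x =>
    x ⬝ᵥ A *ᵥ p.2 - ℓ p.1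
  have hℓ : Continuous ℓ := ℓ.continuous_of_finiteDimensional
  have hcont₁ : ∀ x, Continuous fun p => φ p x := fun x => by
    simp only [φ]
    fun_prop
  have hcont₂ : ∀ p, Continuous fun x => φ p x := fun p => by
    simp only [φ]
    fun_prop
  -- both partial maps are affine
  have haff₁ : ∀ x, ∃ g : (Fin d₃ → ℝ) × (Fin d₂ → ℝ) →ᵃ[ℝ] ℝ, ∀ p, φ p x = g p := fun x =>
    ⟨((dotProductBilin ℝ ℝ x) ∘ₗ A.mulVecLin ∘ₗ LinearMap.snd ℝ _ _).toAffineMap -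
      ℓ.comp (LinearMap.fst ℝ _ _).toAffineMap, fun p => by simp [φ]⟩
  have haff₂ : ∀ p, ∃ g : (Fin d₁ → ℝ) →ᵃ[ℝ] ℝ, ∀ x, φ p x = g x := fun p =>
    ⟨((dotProductBilin ℝ ℝ).flip (A *ᵥ p.2)).toAffineMap - AffineMap.const ℝ _ (ℓ p.1),
      fun x => by simp [φ]⟩
  obtain ⟨p, hp, x, hx, hsad⟩ := Sion.exists_isSaddlePointOn (f := φ) hGne hG.convex hG.isCompact
    (fun x _ => (hcont₁ x).lowerSemicontinuous.lowerSemicontinuousOn _)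
    (fun x _ => by
      obtain ⟨g, hg⟩ := haff₁ x
      have : ConvexOn ℝ G fun p => φ p x := by
        simp only [hg]
        exact (convexOn_id convex_univ).comp_affineMap g |>.subset (Set.subset_univ _) hG.convex
      exact this.quasiconvexOn)
    hC.convex hCne hC.isCompact
    (fun p _ => (hcont₂ p).upperSemicontinuous.upperSemicontinuousOn _)
    (fun p _ => by
      obtain ⟨g, hg⟩ := haff₂ p
      have : ConcaveOn ℝ C fun x => φ p x := by
        simp only [hg]
        exact (concaveOn_id convex_univ).comp_affineMap g |>.subset (Set.subset_univ _) hC.convex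
      exact this.quasiconcaveOn)
  refine ⟨x, hx, fun q hq => ?_⟩
  obtain ⟨x', hx', hle⟩ := h p hp
  have := hsad q hq x' hx'
  simp only [φ] at this
  linarith

/-- The epigraph of `f ↦ min_y max_{w ∈ W} w A y`, where `y` ranges over the fibre of `G` at `f`; no
point lies over an `f` with empty fibre. -/
def valueEpigraph {d₁ d₂ d₃ : ℕ} (A : Matrix (Fin d₁) (Fin d₂) ℝ) (W : Set (Fin d₁ → ℝ))
    (G : Set ((Fin d₃ → ℝ) × (Fin d₂ → ℝ))) : Set ((Fin d₃ → ℝ) × ℝ) :=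
  {p | ∃ y, (p.1, y) ∈ G ∧ ∀ w ∈ W, w ⬝ᵥ A *ᵥ y ≤ p.2}

lemma isHPolyhedron_valueEpigraph {d₁ d₂ d₃ : ℕ} (A : Matrix (Fin d₁) (Fin d₂) ℝ)
    {W : Set (Fin d₁ → ℝ)} (hW : W.Finite) {G : Set ((Fin d₃ → ℝ) × (Fin d₂ → ℝ))}
    (hG : IsPolytope G) : IsHPolyhedron (valueEpigraph A W G) := by
  let drop : ((Fin d₃ → ℝ) × ℝ) × (Fin d₂ → ℝ) →ₗ[ℝ] (Fin d₃ → ℝ) × (Fin d₂ → ℝ) :=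
    (LinearMap.fst ℝ _ _ ∘ₗ LinearMap.fst ℝ _ _).prod (LinearMap.snd ℝ _ _)
  let gap : (Fin d₁ → ℝ) → ((Fin d₃ → ℝ) × ℝ) × (Fin d₂ → ℝ) →ₗ[ℝ] ℝ := fun w =>
    dotProductBilin ℝ ℝ w ∘ₗ A.mulVecLin ∘ₗ LinearMap.snd ℝ _ _ -
      LinearMap.snd ℝ _ _ ∘ₗ LinearMap.fst ℝ _ _
  have h : IsHPolyhedron (drop.toAffineMap ⁻¹' G ∩
      ⋂ w ∈ hW.toFinset, {p | (gap w).toAffineMap p ≤ 0}) :=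
    (hG.isHPolyhedron.preimage _).inter (.biInter _ fun w _ => .halfSpace _)
  convert h.exists_fin using 1
  ext p
  simp [valueEpigraph, drop, gap]

/-- A linear functional bounded on a set by `c` is bounded by `c` on its convex hull. -/
lemma dotProduct_le_of_mem_convexHull {m : ℕ} {W : Set (Fin m → ℝ)} {v x : Fin m → ℝ} {c : ℝ}
    (h : ∀ w ∈ W, w ⬝ᵥ v ≤ c) (hx : x ∈ convexHull ℝ W) : x ⬝ᵥ v ≤ c := by
  have hconv : Convex ℝ {x : Fin m → ℝ | x ⬝ᵥ v ≤ c} :=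
    (convex_Iic c).linear_preimage ((dotProductBilin ℝ ℝ).flip v)
  exact convexHull_min (s := W) (t := {x : Fin m → ℝ | x ⬝ᵥ v ≤ c}) h hconv hx

/-- The value of the parametric program is described by finitely many affine functions `ℓ`, each
guaranteed by one point `x ℓ` of `C`, whatever the parameter. -/
lemma exists_affine_value {d₁ d₂ d₃ : ℕ} (A : Matrix (Fin d₁) (Fin d₂) ℝ)
    {C : Set (Fin d₁ → ℝ)} (hC : IsPolytope C) (hCne : C.Nonempty)
    {G : Set ((Fin d₃ → ℝ) × (Fin d₂ → ℝ))} (hG : IsPolytope G) :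
    ∃ (Λ : Finset ((Fin d₃ → ℝ) →ᵃ[ℝ] ℝ)) (x : ((Fin d₃ → ℝ) →ᵃ[ℝ] ℝ) → Fin d₁ → ℝ),
      (G.Nonempty → Λ.Nonempty) ∧ (∀ ℓ ∈ Λ, x ℓ ∈ C) ∧
      (∀ ℓ ∈ Λ, ∀ f y, (f, y) ∈ G → ℓ f ≤ x ℓ ⬝ᵥ A *ᵥ y) ∧
      ∀ f ∈ Prod.fst '' G, ∀ c, (∀ ℓ ∈ Λ, ℓ f ≤ c) →
        ∃ y, (f, y) ∈ G ∧ ∀ x' ∈ C, x' ⬝ᵥ A *ᵥ y ≤ c := by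
  classical
  obtain ⟨W, hW, rfl⟩ := hC
  have hC : IsPolytope (convexHull ℝ W) := ⟨W, hW, rfl⟩
  have hWne : W.Nonempty := convexHull_nonempty_iff.1 hCne
  -- the largest of the values `w A y`
  have hmax : ∀ y : Fin d₂ → ℝ, ∃ w ∈ W, ∀ w' ∈ W, w' ⬝ᵥ A *ᵥ y ≤ w ⬝ᵥ A *ᵥ y := fun y =>
    Set.exists_max_image W (fun w => w ⬝ᵥ A *ᵥ y) hW hWne
  have hepi : ∀ f y, (f, y) ∈ G → ∃ w ∈ W, (f, w ⬝ᵥ A *ᵥ y) ∈ valueEpigraph A W G := by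
    intro f y hy
    obtain ⟨w, hw, hle⟩ := hmax y
    exact ⟨w, hw, y, hy, hle⟩
  have hline : ∀ f, ∃ t, (f, t) ∉ valueEpigraph A W G := by
    intro f
    obtain ⟨w, hw⟩ := hWne
    have hcont : Continuous fun p : (Fin d₃ → ℝ) × (Fin d₂ → ℝ) => w ⬝ᵥ A *ᵥ p.2 := by fun_prop
    obtain ⟨b, hb⟩ := (hG.isCompact.image hcont).bddBelow
    refine ⟨b - 1, ?_⟩
    rintro ⟨y, hy, hle⟩
    linarith [hb (Set.mem_image_of_mem _ hy), hle w hw]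
  obtain ⟨Λ, hle, hne, hfill⟩ :=
    (isHPolyhedron_valueEpigraph A hW hG).exists_affine_minorants
      (fun f t t' ⟨y, hy, h⟩ htt' => ⟨y, hy, fun w hw => (h w hw).trans htt'⟩) hline
  have hunif : ∀ ℓ ∈ Λ, ∃ x ∈ convexHull ℝ W, ∀ p ∈ G, ℓ p.1 ≤ x ⬝ᵥ A *ᵥ p.2 := by
    refine fun ℓ hℓ => exists_uniform_bound A hC hCne hG ℓ fun p hp => ?_
    obtain ⟨w, hw, h⟩ := hepi p.1 p.2 hp
    exact ⟨w, subset_convexHull ℝ W hw, hle _ _ h ℓ hℓ⟩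
  choose! x hxC hx using hunif
  refine ⟨Λ, x, ?_, hxC, fun ℓ hℓ f y hy => hx ℓ hℓ (f, y) hy, ?_⟩
  · rintro ⟨⟨f, y⟩, hy⟩
    obtain ⟨w, -, h⟩ := hepi f y hy
    exact hne ⟨_, h⟩
  · rintro _ ⟨⟨f, y⟩, hy, rfl⟩ c hc
    obtain ⟨w, -, h⟩ := hepi f y hy
    obtain ⟨z, hz, hzle⟩ := hfill f _ h c hc
    exact ⟨z, hz, fun x' hx' => dotProduct_le_of_mem_convexHull hzle hx'⟩

lemma mem_solutionSet_empty {m n : ℕ} (A : Matrix (Fin m) (Fin n) ℝ) {C : Set (Fin m → ℝ)}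
    {x : Fin m → ℝ} (hx : x ∈ C) : x ∈ solutionSet A C ∅ :=
  ⟨hx, fun x' _ => by simp [innerValue]⟩

/-- A point is optimal as soon as it guarantees a value `c` that some `y ∈ T` does not let the
maximizer exceed. -/
lemma mem_solutionSet_of_saddle {m n : ℕ} (A : Matrix (Fin m) (Fin n) ℝ) {C : Set (Fin m → ℝ)}
    {T : Set (Fin n → ℝ)} {x : Fin m → ℝ} (hx : x ∈ C) {c : ℝ}
    (hlow : ∀ y ∈ T, c ≤ x ⬝ᵥ A *ᵥ y) {y : Fin n → ℝ} (hy : y ∈ T)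
    (hup : ∀ x' ∈ C, x' ⬝ᵥ A *ᵥ y ≤ c) : x ∈ solutionSet A C T := by
  refine ⟨hx, fun x' hx' => le_trans (b := (c : EReal)) ?_ ?_⟩
  · exact (iInf₂_le y hy).trans (EReal.coe_le_coe_iff.2 (hup x' hx'))
  · exact le_iInf₂ fun z hz => EReal.coe_le_coe_iff.2 (hlow z hz)

end PPMP

theorem theoremA4 {d₁ d₂ d₃ p : ℕ}
    (A : Matrix (Fin d₁) (Fin d₂) ℝ)
    (D : Matrix (Fin p) (Fin d₁) ℝ) (d : Fin p → ℝ)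
    (hD : PPMP.IsPolytope (PPMP.feasible D d)) (hDne : (PPMP.feasible D d).Nonempty)
    (F : Set (Fin d₃ → ℝ)) (hF : PPMP.IsPolytope F)
    (q : (Fin d₃ → ℝ) → ℕ)
    (E : (f : Fin d₃ → ℝ) → Matrix (Fin (q f)) (Fin d₂) ℝ)
    (e : (f : Fin d₃ → ℝ) → Fin (q f) → ℝ)
    (hS : PPMP.IsPolytope (PPMP.graphOn F (fun f => PPMP.feasible (E f) (e f)))) :
    PPMP.PolytopialConstant F
      (fun f => PPMP.solutionSet A (PPMP.feasible D d) (PPMP.feasible (E f) (e f))) := by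
  classical
  set C := PPMP.feasible D d
  set S : (Fin d₃ → ℝ) → Set (Fin d₂ → ℝ) := fun f => PPMP.feasible (E f) (e f)
  set G := PPMP.graphOn F S
  obtain ⟨Λ, x, hΛ, hxC, hlow, hup⟩ := PPMP.exists_affine_value A hD hDne hS
  let H := (Λ ×ˢ Λ).image fun ℓ => ℓ.1 - ℓ.2
  obtain ⟨N, Kc, hKc, hsign⟩ := PPMP.exists_polytopialComplex_sign hF H
  have hcell : ∀ l, ∃ z, ∀ f ∈ Kc l, z ∈ PPMP.solutionSet A C (S f) := by
    intro l
    have hKF : Kc l ⊆ F := hKc.cover ▸ Set.subset_iUnion Kc l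
    -- outside the domain of `S` every point of `C` is a solution
    have hout : ∀ z ∈ C, ∀ f ∈ Kc l, f ∉ Prod.fst '' G → z ∈ PPMP.solutionSet A C (S f) := by
      intro z hz f hf hfG
      have hSf : S f = ∅ := Set.eq_empty_iff_forall_notMem.2 fun y hy =>
        hfG ⟨(f, y), ⟨hKF hf, hy⟩, rfl⟩
      rw [hSf]
      exact PPMP.mem_solutionSet_empty A hz
    rcases (Kc l ∩ Prod.fst '' G).eq_empty_or_nonempty with hemp | hne
    · obtain ⟨z, hz⟩ := hDne
      exact ⟨z, fun f hf => hout z hz f hf fun hfG =>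
        Set.notMem_empty f (hemp.subset ⟨hf, hfG⟩)⟩
    have hconv : Convex ℝ (Kc l ∩ Prod.fst '' G) :=
      (hKc.polytope l).convex.inter (hS.convex.linear_image (LinearMap.fst ℝ _ _))
    obtain ⟨c, hc, hcle⟩ := PPMP.exists_forall_le_zero hconv hne H fun h hh =>
      (hsign l h hh).imp (fun h0 f hf => h0 f hf.1) fun h0 f hf => h0 f hf.1
    obtain ⟨g, hg, -⟩ := hc.2
    obtain ⟨ℓ, hℓ, hmax⟩ := Λ.exists_max_image (fun ℓ => ℓ c) (hΛ ⟨g, hg⟩)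
    refine ⟨x ℓ, fun f hf => ?_⟩
    by_cases hfG : f ∈ Prod.fst '' G
    · -- the affine function that is maximal at `c` is maximal at every `f` of the cell
      have hmaxf : ∀ ℓ' ∈ Λ, ℓ' f ≤ ℓ f := by
        intro ℓ' hℓ'
        have h := hcle (ℓ' - ℓ)
          (Finset.mem_image.2 ⟨(ℓ', ℓ), Finset.mem_product.2 ⟨hℓ', hℓ⟩, rfl⟩)
          (by simpa using hmax ℓ' hℓ') f ⟨hf, hfG⟩
        simpa using h
      obtain ⟨y, hy, hyle⟩ := hup f hfG (ℓ f) hmaxf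
      exact PPMP.mem_solutionSet_of_saddle A (hxC ℓ hℓ)
        (fun z hz => hlow ℓ hℓ f z ⟨hKF hf, hz⟩) hy.2 hyle
    · exact hout _ (hxC ℓ hℓ) f hf hfG
  choose z hz using hcell
  exact ⟨N, Kc, z, hKc, hz⟩
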